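/- Let $\mu>-\tfrac12$ and $\lambda>0$. For $x>0$ put $r(x)=x^{-\mu-1/2}$ and $s(x)=x^{2\mu+1}/c_\mu$, where $c_\mu=2^{\mu}\Gamma(\mu+1)$, and for a weight $w\ge 0$ on $(0,\infty)$ let $L^1(w)$ be the space of measurable $f:(0,\infty)\to\mathbb{C}$ with $\|f\|_{L^1(w)}=\int_0^\infty |f(x)|\,w(x)\,dx<\infty$. Let $$\mathcal K_\mu(x)=\frac12\Bigl(\frac x2\Bigr)^{\mu}\int_0^\infty e^{-t-\frac{x^2}{4t}}\,\frac{dt}{t^{\mu+1}},\qquad N_\lambda(x)=\lambda^{\mu/2}\,x^{1/2}\,\mathcal K_\mu(\sqrt\lambda\,x),\qquad x>0,$$ let $J_\mu(x)=\sum_{k=0}^\infty\frac{(-1)^k}{k!\,\Gamma(\mu+k+1)}\bigl(\frac x2\bigr)^{2k+\mu}$ be the Bessel function of the first kind of order $\mu$, and let $$h_\mu\phi(y)=\int_0^\infty \sqrt{xy}\,J_\mu(xy)\,\phi(x)\,dx,\qquad y>0,$$ be the Hankel transform. Then: (a) $L^1(sr)=L^1(r^{-1}/c_\mu)$ (with the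 same norm), $N_\lambda\in L^1(sr)$, and $\|N_\lambda\|_{L^1(sr)}=\dfrac1\lambda$. (b) For every $y>0$ the integral defining $h_\mu N_\lambda(y)$ converges absolutely, and $$h_\mu N_\lambda(y)=\frac{y^{\mu+1/2}}{\lambda+y^2}.$$ -/

import Mathlib

open MeasureTheory

noncomputable section

namespace HankelKernel

/-- The constant `c_μ = 2^μ Γ(μ + 1)`. -/
def cConst (μ : ℝ) : ℝ := (2 : ℝ) ^ μ * Real.Gamma (μ + 1)

/-- The weight `r(x) = x^(-μ - 1/2)` on `(0, ∞)`. -/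
def rWeight (μ x : ℝ) : ℝ := x ^ (-μ - 1 / 2)

/-- The weight `s(x) = x^(2μ + 1) / c_μ` on `(0, ∞)`. -/
def sWeight (μ x : ℝ) : ℝ := x ^ (2 * μ + 1) / cConst μ

/-- The measure `w(x) dx` on `(0, ∞)`, for a weight `w` that is nonnegative there. The space
`L^p(w)` is the `L^p` space of this measure. -/
def weightedMeasure (w : ℝ → ℝ) : Measure ℝ :=
  (volume.restrict (Set.Ioi 0)).withDensity fun x => ENNReal.ofReal (w x)

/-- The Bessel function of the first kind and order `μ` on `(0, ∞)`, by its power series. -/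
def besselJ (μ x : ℝ) : ℝ :=
  ∑' k : ℕ, (-1 : ℝ) ^ k / ((k.factorial : ℝ) * Real.Gamma (μ + k + 1))
    * (x / 2) ^ (2 * (k : ℝ) + μ)

/-- The function `K_ν(x) = (1/2) (x/2)^ν ∫_0^∞ exp(-t - x^2/(4t)) dt / t^(ν + 1)`, for `x > 0`. -/
def besselK (ν x : ℝ) : ℝ :=
  1 / 2 * (x / 2) ^ ν * ∫ t in Set.Ioi (0 : ℝ), Real.exp (-t - x ^ 2 / (4 * t)) / t ^ (ν + 1)

/-- The kernel `N_λ(x) = λ^(μ/2) x^(1/2) K_μ(√λ x)`, for `x > 0`, as a complex-valued function. -/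
def kernelN (μ lam : ℝ) (x : ℝ) : ℂ :=
  ((lam ^ (μ / 2) * x ^ (1 / 2 : ℝ) * besselK μ (Real.sqrt lam * x) : ℝ) : ℂ)

/-- The integrand `√(xy) J_μ(xy) φ(y)` of the Hankel transform of `φ` at `x`. -/
def hankelIntegrand (μ : ℝ) (φ : ℝ → ℂ) (x y : ℝ) : ℂ :=
  ((Real.sqrt (x * y) * besselJ μ (x * y) : ℝ) : ℂ) * φ y

/-- The Hankel transform `h_μ φ(x) = ∫_0^∞ √(xy) J_μ(xy) φ(y) dy`. -/
def hankelTransform (μ : ℝ) (φ : ℝ → ℂ) (x : ℝ) : ℂ :=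
  ∫ y in Set.Ioi (0 : ℝ), hankelIntegrand μ φ x y

end HankelKernel

end

/-! Up to the factor `(λ/2)^μ / 2`, the function `x^(μ+1/2) N_λ(x)` is the `t`-marginal of the
positive density `x^(2μ+1) e^(-λx²/(4t)) e^(-t) t^(-μ-1)` (`rpow_mul_kernelN`). For fixed `t` this
is a Gaussian in `x`, so both claims follow by integrating in `x` first.

The Gaussian moment produces `(λ/(4t))^(-(μ+1))`, whose power of `t` cancels `t^(-(μ+1))`. What
remains is a constant times `e^(-t)`, with total mass 1: this gives the norm.

For the transform, `√(xy) J_μ(xy) = 2^(-μ) (xy)^(μ+1/2) E(xy)` with `E = besselEven μ`. Integrating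
`E(yx)` against the Gaussian adds a factor `e^(-y²t/λ)` (`integral_besselEven_mul_gaussian`), and
the `t`-integral becomes `λ/(λ+y²)`. Poisson's integral bounds `E` for `μ > -1/2`
(`abs_besselEven_le`), so integrability of the density alone justifies Fubini and the absolute
convergence. -/

namespace HankelKernel

/-! ### Poisson's integral and the bound on the even Bessel factor -/

/-- The real beta integral, with its convergence. -/
lemma integrableOn_and_integral_beta {a b : ℝ} (ha : 0 < a) (hb : 0 < b) :
    IntegrableOn (fun u : ℝ => u ^ (a - 1) * (1 - u) ^ (b - 1)) (Set.Ioo 0 1) ∧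
      ∫ u in Set.Ioo (0 : ℝ) 1, u ^ (a - 1) * (1 - u) ^ (b - 1) =
        Real.Gamma a * Real.Gamma b / Real.Gamma (a + b) := by
  have hconv := Complex.betaIntegral_convergent (u := (a : ℂ)) (v := (b : ℂ)) (by simpa) (by simpa)
  rw [intervalIntegrable_iff_integrableOn_Ioo_of_le zero_le_one] at hconv
  have heq : Set.EqOn
      (fun x : ℝ => ((x : ℂ) ^ ((a : ℂ) - 1) * (1 - (x : ℂ)) ^ ((b : ℂ) - 1)))
      (fun u : ℝ => ((u ^ (a - 1) * (1 - u) ^ (b - 1) : ℝ) : ℂ)) (Set.Ioo 0 1) := by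
    intro x hx
    have h1 : (0 : ℝ) ≤ 1 - x := by linarith [hx.2]
    simp only
    rw [Complex.ofReal_mul, Complex.ofReal_cpow hx.1.le, Complex.ofReal_cpow h1]
    push_cast
    rfl
  have hint : IntegrableOn (fun u : ℝ => ((u ^ (a - 1) * (1 - u) ^ (b - 1) : ℝ) : ℂ))
      (Set.Ioo 0 1) := (integrableOn_congr_fun heq measurableSet_Ioo).1 hconv
  have hreal : IntegrableOn (fun u : ℝ => u ^ (a - 1) * (1 - u) ^ (b - 1)) (Set.Ioo 0 1) := by
    simpa using! hint.re
  refine ⟨hreal, ?_⟩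
  have h := Complex.betaIntegral_eq_Gamma_mul_div (a : ℂ) (b : ℂ) (by simpa) (by simpa)
  rw [Complex.betaIntegral, intervalIntegral.integral_of_le zero_le_one,
    integral_Ioc_eq_integral_Ioo, setIntegral_congr_fun measurableSet_Ioo heq,
    integral_complex_ofReal, ← Complex.ofReal_add, Complex.Gamma_ofReal, Complex.Gamma_ofReal,
    Complex.Gamma_ofReal] at h
  exact_mod_cast h

/-- The entire function `∑ (-1)^k / (k! Γ(μ + k + 1)) (z/2)^(2k)`, the even factor of `J_μ`. -/
noncomputable def besselEven (μ z : ℝ) : ℝ :=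
  ∑' k : ℕ, (-1 : ℝ) ^ k / ((k.factorial : ℝ) * Real.Gamma (μ + k + 1)) * (z / 2) ^ (2 * k)

lemma besselJ_eq_mul_besselEven (μ : ℝ) {x : ℝ} (hx : 0 < x) :
    besselJ μ x = (x / 2) ^ μ * besselEven μ x := by
  rw [besselJ, besselEven, ← tsum_mul_left]
  congr 1 with k
  rw [Real.rpow_add (by positivity), show (2 : ℝ) * k = ((2 * k : ℕ) : ℝ) by push_cast; rfl,
    Real.rpow_natCast]
  ring

lemma factorial_two_mul_mul_sqrt_pi (k : ℕ) :
    ((2 * k).factorial : ℝ) * √Real.pi =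
      4 ^ k * (k.factorial : ℝ) * Real.Gamma (k + 1 / 2) := by
  rw [Real.Gamma_nat_add_half]
  rcases k with _ | k
  · simp
  · have h : (2 * (k + 1)).factorial = 2 ^ (k + 1) * (k + 1).factorial *
        (2 * (k + 1) - 1).doubleFactorial := by
      rw [show 2 * (k + 1) = (2 * k + 1) + 1 by ring, Nat.factorial_eq_mul_doubleFactorial,
        show 2 * k + 1 + 1 = 2 * (k + 1) by ring, Nat.doubleFactorial_two_mul]
      rfl
    rw [h]
    push_cast
    rw [show (4 : ℝ) = 2 * 2 by norm_num, mul_pow]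
    field_simp

/-- Poisson's integral representation, as a termwise integrated cosine series. -/
lemma hasSum_besselEven {μ : ℝ} (hμ : -(1 / 2 : ℝ) < μ) (z : ℝ) :
    HasSum (fun k : ℕ =>
        (-1 : ℝ) ^ k / ((k.factorial : ℝ) * Real.Gamma (μ + k + 1)) * (z / 2) ^ (2 * k))
      ((√Real.pi * Real.Gamma (μ + 1 / 2))⁻¹ *
        ∫ u in Set.Ioo (0 : ℝ) 1,
          u ^ ((1 / 2 : ℝ) - 1) * (1 - u) ^ (μ + 1 / 2 - 1) * Real.cos (z * √u)) := by
  have hw := (integrableOn_and_integral_beta (a := 1 / 2) (b := μ + 1 / 2) (by norm_num)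
    (by linarith)).1
  have hΓ : 0 < Real.Gamma (μ + 1 / 2) := Real.Gamma_pos_of_pos (by linarith)
  have hsum : Summable fun k : ℕ => |z| ^ (2 * k) / ((2 * k).factorial : ℝ) :=
    (Real.hasSum_cosh |z|).summable
  -- Since `√u ≤ 1`, the cosine series is dominated termwise by the series of `cosh |z|`.
  have key := hasSum_integral_of_dominated_convergence
    (μ := volume.restrict (Set.Ioo (0 : ℝ) 1))
    (F := fun (k : ℕ) (u : ℝ) => u ^ ((1 / 2 : ℝ) - 1) * (1 - u) ^ (μ + 1 / 2 - 1) *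
      ((-1) ^ k * (z * √u) ^ (2 * k) / ((2 * k).factorial : ℝ)))
    (f := fun u => u ^ ((1 / 2 : ℝ) - 1) * (1 - u) ^ (μ + 1 / 2 - 1) * Real.cos (z * √u))
    (fun k u => |z| ^ (2 * k) / ((2 * k).factorial : ℝ) *
      (u ^ ((1 / 2 : ℝ) - 1) * (1 - u) ^ (μ + 1 / 2 - 1)))
    (fun k => by
      refine Measurable.aestronglyMeasurable ?_
      fun_prop)
    (fun k => by
      filter_upwards [ae_restrict_mem measurableSet_Ioo] with u hu
      have h1 : 0 < 1 - u := by linarith [hu.2]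
      have h0 := hu.1
      have hs : √u ≤ 1 := Real.sqrt_le_one.2 hu.2.le
      rw [norm_mul, Real.norm_of_nonneg (by positivity), mul_comm]
      gcongr
      rw [norm_div, norm_mul, norm_pow, norm_pow, norm_mul]
      simp only [norm_neg, norm_one, one_pow, one_mul, Real.norm_eq_abs, Nat.abs_cast]
      gcongr
      rw [abs_of_nonneg (Real.sqrt_nonneg u)]
      exact mul_le_of_le_one_right (abs_nonneg _) hs)
    (by
      filter_upwards with u
      exact hsum.mul_right _)
    (by
      simp_rw [tsum_mul_right]
      exact hw.const_mul _)
    (by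
      filter_upwards with u
      exact (Real.hasSum_cos (z * √u)).mul_left _)
  convert! key.mul_left (√Real.pi * Real.Gamma (μ + 1 / 2))⁻¹ using 1
  ext k
  -- The factor `(√u)^(2k) = u^k` shifts the first beta parameter from `1/2` to `k + 1/2`.
  have hB := (integrableOn_and_integral_beta (a := k + 1 / 2) (b := μ + 1 / 2) (by positivity)
    (by linarith)).2
  have : ∫ u in Set.Ioo (0 : ℝ) 1, u ^ ((1 / 2 : ℝ) - 1) * (1 - u) ^ (μ + 1 / 2 - 1) *
      ((-1) ^ k * (z * √u) ^ (2 * k) / ((2 * k).factorial : ℝ)) =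
      ((-1) ^ k * z ^ (2 * k) / ((2 * k).factorial : ℝ)) *
      ∫ u in Set.Ioo (0 : ℝ) 1, u ^ ((k : ℝ) + 1 / 2 - 1) * (1 - u) ^ (μ + 1 / 2 - 1) := by
    rw [← integral_const_mul]
    refine setIntegral_congr_fun measurableSet_Ioo fun u hu => ?_
    rw [mul_pow, pow_mul (√u), Real.sq_sqrt hu.1.le, add_sub_assoc (k : ℝ), Real.rpow_add hu.1,
      Real.rpow_natCast]
    ring
  rw [this, hB, show (k : ℝ) + 1 / 2 + (μ + 1 / 2) = μ + k + 1 by ring]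
  have hf := factorial_two_mul_mul_sqrt_pi k
  have hΓk : 0 < Real.Gamma (μ + k + 1) :=
    Real.Gamma_pos_of_pos (by have : (0 : ℝ) ≤ k := k.cast_nonneg; linarith)
  have hπ : 0 < √Real.pi := Real.sqrt_pos.2 Real.pi_pos
  rw [div_pow, pow_mul 2 2 k, show (2 : ℝ) ^ 2 = 4 by norm_num]
  generalize Real.Gamma (μ + 1 / 2) = A at hΓ ⊢
  generalize Real.Gamma ((k : ℝ) + 1 / 2) = B at hf ⊢
  field_simp
  linear_combination z ^ (2 * k) * hf

lemma summable_besselEven {μ : ℝ} (hμ : -(1 / 2 : ℝ) < μ) (z : ℝ) :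
    Summable fun k : ℕ =>
      (-1 : ℝ) ^ k / ((k.factorial : ℝ) * Real.Gamma (μ + k + 1)) * (z / 2) ^ (2 * k) :=
  (hasSum_besselEven hμ z).summable

/-- Bounding the cosine by 1 in Poisson's integral leaves a beta integral; the bound is the value at
`z = 0`. -/
lemma abs_besselEven_le {μ : ℝ} (hμ : -(1 / 2 : ℝ) < μ) (z : ℝ) :
    |besselEven μ z| ≤ (Real.Gamma (μ + 1))⁻¹ := by
  have hw := integrableOn_and_integral_beta (a := 1 / 2) (b := μ + 1 / 2) (by norm_num)
    (by linarith)
  have hΓ : 0 < Real.Gamma (μ + 1 / 2) := Real.Gamma_pos_of_pos (by linarith)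
  have hπ : 0 < √Real.pi := Real.sqrt_pos.2 Real.pi_pos
  rw [besselEven, (hasSum_besselEven hμ z).tsum_eq, abs_mul, abs_of_pos (by positivity)]
  calc _ ≤ (√Real.pi * Real.Gamma (μ + 1 / 2))⁻¹ *
        ∫ u in Set.Ioo (0 : ℝ) 1, u ^ ((1 / 2 : ℝ) - 1) * (1 - u) ^ (μ + 1 / 2 - 1) := by
        gcongr
        rw [← Real.norm_eq_abs]
        refine norm_integral_le_of_norm_le hw.1 ?_
        filter_upwards [ae_restrict_mem measurableSet_Ioo] with u hu
        have h1 : 0 < 1 - u := by linarith [hu.2]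
        have h0 := hu.1
        rw [norm_mul, Real.norm_of_nonneg (by positivity)]
        exact mul_le_of_le_one_right (by positivity) (Real.abs_cos_le_one _)
    _ = _ := by
        rw [hw.2, show (1 / 2 : ℝ) + (μ + 1 / 2) = μ + 1 by ring, Real.Gamma_one_half_eq]
        generalize Real.Gamma (μ + 1 / 2) = A at hΓ ⊢
        field_simp

lemma measurable_besselEven {μ : ℝ} (hμ : -(1 / 2 : ℝ) < μ) : Measurable (besselEven μ) := by
  refine measurable_of_tendsto_metrizable (f := fun n z => ∑ k ∈ Finset.range n,
    (-1 : ℝ) ^ k / ((k.factorial : ℝ) * Real.Gamma (μ + k + 1)) * (z / 2) ^ (2 * k))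
    (fun n => by fun_prop) ?_
  rw [tendsto_pi_nhds]
  exact fun z => (summable_besselEven hμ z).hasSum.tendsto_sum_nat

/-! ### Gaussian integrals -/

/-- Moments of the Gaussian on the half line. -/
lemma integral_rpow_mul_gaussian {ν a : ℝ} (hν : -1 < ν) (ha : 0 < a) :
    IntegrableOn (fun x : ℝ => x ^ (2 * ν + 1) * Real.exp (-a * x ^ 2)) (Set.Ioi 0) ∧
      ∫ x in Set.Ioi (0 : ℝ), x ^ (2 * ν + 1) * Real.exp (-a * x ^ 2) =
        a ^ (-(ν + 1)) / 2 * Real.Gamma (ν + 1) := by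
  refine ⟨integrableOn_rpow_mul_exp_neg_mul_sq ha (by linarith), ?_⟩
  have h := integral_rpow_mul_exp_neg_mul_rpow (p := 2) (q := 2 * ν + 1) two_pos (by linarith) ha
  simp only [Real.rpow_two] at h
  rw [h, show -(2 * ν + 1 + 1) / 2 = -(ν + 1) by ring, show (2 * ν + 1 + 1) / 2 = ν + 1 by ring]
  ring

/-- The Gaussian is, up to scaling, its own Hankel transform. -/
lemma integral_besselEven_mul_gaussian {μ a : ℝ} (hμ : -(1 / 2 : ℝ) < μ) (ha : 0 < a) (y : ℝ) :
    ∫ x in Set.Ioi (0 : ℝ),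
        besselEven μ (y * x) * (x ^ (2 * μ + 1) * Real.exp (-a * x ^ 2)) =
      a ^ (-(μ + 1)) / 2 * Real.exp (-(y ^ 2 / (4 * a))) := by
  let F : ℕ → ℝ → ℝ := fun k x =>
    (-1 : ℝ) ^ k / ((k.factorial : ℝ) * Real.Gamma (μ + k + 1)) * (y / 2) ^ (2 * k) *
      (x ^ (2 * (μ + k) + 1) * Real.exp (-a * x ^ 2))
  have hk (k : ℕ) : -1 < μ + k := by have : (0 : ℝ) ≤ k := k.cast_nonneg; linarith
  have hΓ (k : ℕ) : 0 < Real.Gamma (μ + k + 1) := Real.Gamma_pos_of_pos (by linarith [hk k])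
  have hpow (k : ℕ) : a ^ (-(μ + k + 1)) = a ^ (-(μ + 1)) / a ^ k := by
    rw [show -(μ + (k : ℝ) + 1) = -(μ + 1) - k by ring, Real.rpow_sub ha, Real.rpow_natCast]
  have hint (k : ℕ) : IntegrableOn (F k) (Set.Ioi 0) :=
    (integral_rpow_mul_gaussian (hk k) ha).1.const_mul _
  have hnorm (k : ℕ) : ∫ x in Set.Ioi (0 : ℝ), ‖F k x‖ =
      a ^ (-(μ + 1)) / 2 * ((y ^ 2 / (4 * a)) ^ k / (k.factorial : ℝ)) := by
    have : ∫ x in Set.Ioi (0 : ℝ), ‖F k x‖ =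
        1 / ((k.factorial : ℝ) * Real.Gamma (μ + k + 1)) * (y / 2) ^ (2 * k) *
          ∫ x in Set.Ioi (0 : ℝ), x ^ (2 * (μ + k) + 1) * Real.exp (-a * x ^ 2) := by
      rw [← integral_const_mul]
      refine setIntegral_congr_fun measurableSet_Ioi fun x hx => ?_
      have hx : 0 < x := hx
      have := hΓ k
      have h2 : 0 ≤ (y / 2) ^ (2 * k) := by rw [pow_mul]; positivity
      simp only [F]
      rw [norm_mul, norm_mul, norm_div, norm_pow, norm_neg, norm_one, one_pow,
        Real.norm_of_nonneg (by positivity : 0 ≤ (k.factorial : ℝ) * Real.Gamma (μ + k + 1)),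
        Real.norm_of_nonneg h2,
        Real.norm_of_nonneg
          (by positivity : 0 ≤ x ^ (2 * (μ + k) + 1) * Real.exp (-a * x ^ 2))]
    rw [this, (integral_rpow_mul_gaussian (hk k) ha).2, hpow, pow_mul, div_pow, div_pow, div_pow,
      mul_pow]
    have := (hΓ k).ne'
    field_simp
    norm_num
  have hval (k : ℕ) : ∫ x in Set.Ioi (0 : ℝ), F k x =
      a ^ (-(μ + 1)) / 2 * ((-(y ^ 2 / (4 * a))) ^ k / (k.factorial : ℝ)) := by
    simp only [F]
    rw [integral_const_mul, (integral_rpow_mul_gaussian (hk k) ha).2, hpow, pow_mul, div_pow y,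
      neg_pow (y ^ 2 / (4 * a)), div_pow (y ^ 2), div_pow (y ^ 2), mul_pow]
    have := (hΓ k).ne'
    field_simp
    norm_num
  have hexp (t : ℝ) : HasSum (fun k : ℕ => t ^ k / (k.factorial : ℝ)) (Real.exp t) := by
    rw [Real.exp_eq_exp_ℝ]
    exact NormedSpace.expSeries_div_hasSum_exp t
  -- The `L¹` norms of the terms form the exponential series at `y²/(4a)`; the signed integrals form
  -- the one at `-y²/(4a)`.
  have key := hasSum_integral_of_summable_integral_norm hint (by
    simp_rw [hnorm]
    exact (hexp _).summable.mul_left _)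
  simp_rw [hval] at key
  rw [← key.unique ((hexp _).mul_left _)]
  refine setIntegral_congr_fun measurableSet_Ioi fun x hx => ?_
  simp only [besselEven, F]
  rw [← tsum_mul_right]
  congr 1 with k
  rw [show 2 * (μ + (k : ℝ)) + 1 = 2 * μ + 1 + ((2 * k : ℕ) : ℝ) by push_cast; ring,
    Real.rpow_add hx _ ((2 * k : ℕ) : ℝ), Real.rpow_natCast, show y * x / 2 = y / 2 * x by ring, mul_pow]
  ring

/-! ### The joint density and Fubini -/

/-- The density on `(0, ∞) × (0, ∞)` whose marginal in `x` is, up to a constant,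
`x^(μ + 1/2) N_λ(x)`. -/
noncomputable def jointDensity (μ lam x t : ℝ) : ℝ :=
  x ^ (2 * μ + 1) * Real.exp (-(lam / (4 * t)) * x ^ 2) * (Real.exp (-t) / t ^ (μ + 1))

lemma jointDensity_nonneg (μ lam : ℝ) {x t : ℝ} (hx : 0 < x) (ht : 0 < t) :
    0 ≤ jointDensity μ lam x t := by
  unfold jointDensity
  positivity

lemma rpow_mul_kernelN (μ : ℝ) {lam x : ℝ} (hlam : 0 < lam) (hx : 0 < x) :
    ((x ^ (μ + 1 / 2) : ℝ) : ℂ) * kernelN μ lam x =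
      (((lam / 2) ^ μ / 2 * ∫ t in Set.Ioi (0 : ℝ), jointDensity μ lam x t : ℝ) : ℂ) := by
  have hint : ∫ t in Set.Ioi (0 : ℝ), jointDensity μ lam x t =
      x ^ (2 * μ + 1) *
        ∫ t in Set.Ioi (0 : ℝ), Real.exp (-t - (√lam * x) ^ 2 / (4 * t)) / t ^ (μ + 1) := by
    rw [← integral_const_mul]
    refine setIntegral_congr_fun measurableSet_Ioi fun t ht => ?_
    simp only [jointDensity]
    rw [mul_pow, Real.sq_sqrt hlam.le,
      show -t - lam * x ^ 2 / (4 * t) = -(lam / (4 * t)) * x ^ 2 + -t by ring, Real.exp_add]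
    ring
  rw [kernelN, besselK, hint, ← Complex.ofReal_mul]
  congr 1
  rw [show 2 * μ + 1 = (μ + 1 / 2) + (1 / 2 + μ) by ring,
    Real.rpow_add hx (μ + 1 / 2), Real.rpow_add hx (1 / 2) μ,
    Real.div_rpow (by positivity) zero_le_two, Real.div_rpow hlam.le zero_le_two,
    Real.mul_rpow (by positivity) hx.le, Real.sqrt_eq_rpow, ← Real.rpow_mul hlam.le,
    show lam ^ μ = lam ^ (μ / 2) * lam ^ (1 / 2 * μ) by rw [← Real.rpow_add hlam]; congr 1; ring]
  ring

/-- With `ν = μ + 1`, this is the cancellation that leaves a pure exponential in `t`. -/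
lemma rpow_neg_mul_div_rpow {lam t : ℝ} (hlam : 0 < lam) (ht : 0 < t) (ν : ℝ) :
    (lam / (4 * t)) ^ (-ν) / t ^ ν = (4 / lam) ^ ν := by
  rw [Real.rpow_neg (by positivity), ← Real.inv_rpow (by positivity), inv_div,
    ← Real.div_rpow (by positivity) ht.le]
  congr 1
  field_simp

lemma integral_jointDensity_left {μ lam t : ℝ} (hμ : -(1 / 2 : ℝ) < μ) (hlam : 0 < lam)
    (ht : 0 < t) :
    ∫ x in Set.Ioi (0 : ℝ), jointDensity μ lam x t =
      (4 / lam) ^ (μ + 1) / 2 * Real.Gamma (μ + 1) * Real.exp (-t) := by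
  unfold jointDensity
  rw [integral_mul_const, (integral_rpow_mul_gaussian (by linarith) (by positivity)).2,
    ← rpow_neg_mul_div_rpow hlam ht]
  ring

lemma integral_besselEven_mul_jointDensity_left {μ lam t : ℝ} (hμ : -(1 / 2 : ℝ) < μ)
    (hlam : 0 < lam) (ht : 0 < t) (y : ℝ) :
    ∫ x in Set.Ioi (0 : ℝ), besselEven μ (y * x) * jointDensity μ lam x t =
      (4 / lam) ^ (μ + 1) / 2 * Real.exp (-(1 + y ^ 2 / lam) * t) := by
  unfold jointDensity
  simp_rw [← mul_assoc (besselEven _ _) (_ * _)]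
  rw [integral_mul_const, integral_besselEven_mul_gaussian hμ (by positivity),
    ← rpow_neg_mul_div_rpow hlam ht,
    show -(1 + y ^ 2 / lam) * t = -(y ^ 2 / (4 * (lam / (4 * t)))) + -t by field_simp; ring,
    Real.exp_add]
  ring

lemma integrable_jointDensity {μ lam : ℝ} (hμ : -(1 / 2 : ℝ) < μ) (hlam : 0 < lam) :
    Integrable (fun p : ℝ × ℝ => jointDensity μ lam p.1 p.2)
      ((volume.restrict (Set.Ioi 0)).prod (volume.restrict (Set.Ioi 0))) := by
  rw [integrable_prod_iff' (by
    refine Measurable.aestronglyMeasurable ?_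
    unfold jointDensity
    fun_prop)]
  constructor
  · filter_upwards [ae_restrict_mem measurableSet_Ioi] with t (ht : 0 < t)
    exact (integral_rpow_mul_gaussian (by linarith) (by positivity)).1.mul_const _
  · refine Integrable.congr (f := fun t : ℝ =>
      (4 / lam) ^ (μ + 1) / 2 * Real.Gamma (μ + 1) * Real.exp (-t))
      ((integrableOn_exp_neg_Ioi 0).const_mul _) ?_
    filter_upwards [ae_restrict_mem measurableSet_Ioi] with t (ht : 0 < t)
    rw [← integral_jointDensity_left hμ hlam ht]
    refine setIntegral_congr_fun measurableSet_Ioi fun x hx => ?_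
    exact (Real.norm_of_nonneg (jointDensity_nonneg μ lam hx ht)).symm

lemma integral_integral_jointDensity {μ lam : ℝ} (hμ : -(1 / 2 : ℝ) < μ) (hlam : 0 < lam) :
    ∫ x in Set.Ioi (0 : ℝ), ∫ t in Set.Ioi (0 : ℝ), jointDensity μ lam x t =
      (4 / lam) ^ (μ + 1) / 2 * Real.Gamma (μ + 1) := by
  rw [integral_integral_swap (integrable_jointDensity hμ hlam),
    setIntegral_congr_fun measurableSet_Ioi fun t ht => integral_jointDensity_left hμ hlam ht,
    integral_const_mul, integral_exp_neg_Ioi_zero, mul_one]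

lemma integrable_besselEven_mul_jointDensity {μ lam : ℝ} (hμ : -(1 / 2 : ℝ) < μ) (hlam : 0 < lam)
    (y : ℝ) :
    Integrable (fun p : ℝ × ℝ => besselEven μ (y * p.1) * jointDensity μ lam p.1 p.2)
      ((volume.restrict (Set.Ioi 0)).prod (volume.restrict (Set.Ioi 0))) :=
  (integrable_jointDensity hμ hlam).bdd_mul
    ((measurable_besselEven hμ).comp (measurable_fst.const_mul y)).aestronglyMeasurable
    (.of_forall fun p => abs_besselEven_le hμ (y * p.1))

lemma integral_integral_besselEven_mul_jointDensity {μ lam : ℝ} (hμ : -(1 / 2 : ℝ) < μ)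
    (hlam : 0 < lam) (y : ℝ) :
    ∫ x in Set.Ioi (0 : ℝ), ∫ t in Set.Ioi (0 : ℝ),
        besselEven μ (y * x) * jointDensity μ lam x t =
      (4 / lam) ^ (μ + 1) / 2 * (lam / (lam + y ^ 2)) := by
  have h : 0 < 1 + y ^ 2 / lam := by positivity
  rw [integral_integral_swap (integrable_besselEven_mul_jointDensity hμ hlam y),
    setIntegral_congr_fun measurableSet_Ioi fun t ht =>
      integral_besselEven_mul_jointDensity_left hμ hlam ht y,
    integral_const_mul, integral_exp_mul_Ioi (by linarith)]
  simp only [mul_zero, Real.exp_zero]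
  congr 1
  field_simp

/-! ### Constants, weights and the norm of the kernel -/

/-- The product of the marginal's prefactor and the Gaussian constant, common to the norm and the
transform. -/
lemma rpow_const_identity {lam : ℝ} (hlam : 0 < lam) (μ : ℝ) :
    (lam / 2) ^ μ / 2 * ((4 / lam) ^ (μ + 1) / 2) = 2 ^ μ / lam := by
  rw [Real.rpow_add (by positivity), Real.rpow_one,
    show (2 : ℝ) ^ μ = (lam / 2) ^ μ * (4 / lam) ^ μ by
      rw [← Real.mul_rpow (by positivity) (by positivity)]; congr 1; field_simp; norm_num]
  field_simp
  norm_num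

lemma cConst_pos {μ : ℝ} (hμ : -(1 / 2 : ℝ) < μ) : 0 < cConst μ :=
  mul_pos (by positivity) (Real.Gamma_pos_of_pos (by linarith))

lemma sWeight_mul_rWeight (μ : ℝ) {x : ℝ} (hx : 0 < x) :
    sWeight μ x * rWeight μ x = x ^ (μ + 1 / 2) / cConst μ := by
  rw [sWeight, rWeight, div_mul_eq_mul_div, ← Real.rpow_add hx]
  ring_nf

lemma weightedMeasure_congr {w w' : ℝ → ℝ} (h : ∀ x, 0 < x → w x = w' x) :
    weightedMeasure w = weightedMeasure w' := by
  refine withDensity_congr_ae ?_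
  filter_upwards [ae_restrict_mem measurableSet_Ioi] with x hx
  rw [h x hx]

lemma weightedMeasure_sWeight_mul_rWeight (μ : ℝ) :
    weightedMeasure (fun x => sWeight μ x * rWeight μ x) =
      weightedMeasure (fun x => x ^ (μ + 1 / 2) / cConst μ) :=
  weightedMeasure_congr fun _ hx => sWeight_mul_rWeight μ hx

lemma weightedMeasure_inv_rWeight (μ : ℝ) :
    weightedMeasure (fun x => (rWeight μ x)⁻¹ / cConst μ) =
      weightedMeasure (fun x => x ^ (μ + 1 / 2) / cConst μ) :=
  weightedMeasure_congr fun x hx => by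
    rw [rWeight, ← Real.rpow_neg hx.le]
    ring_nf

lemma weight_smul_kernelN {μ lam x : ℝ} (hμ : -(1 / 2 : ℝ) < μ) (hlam : 0 < lam) (hx : 0 < x) :
    (ENNReal.ofReal (x ^ (μ + 1 / 2) / cConst μ)).toReal • kernelN μ lam x =
      (((lam / 2) ^ μ / 2 / cConst μ * ∫ t in Set.Ioi (0 : ℝ), jointDensity μ lam x t : ℝ) : ℂ) := by
  have hc := cConst_pos hμ
  rw [ENNReal.toReal_ofReal (by positivity), Complex.real_smul, Complex.ofReal_div,
    div_mul_eq_mul_div, rpow_mul_kernelN μ hlam hx, ← Complex.ofReal_div]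
  congr 1
  ring

lemma integrable_kernelN {μ lam : ℝ} (hμ : -(1 / 2 : ℝ) < μ) (hlam : 0 < lam) :
    Integrable (kernelN μ lam) (weightedMeasure fun x => x ^ (μ + 1 / 2) / cConst μ) := by
  rw [weightedMeasure, integrable_withDensity_iff_integrable_smul' (by fun_prop)
    (.of_forall fun _ => ENNReal.ofReal_lt_top)]
  refine (((integrable_jointDensity hμ hlam).integral_prod_left.const_mul
    ((lam / 2) ^ μ / 2 / cConst μ)).ofReal (𝕜 := ℂ)).congr ?_
  filter_upwards [ae_restrict_mem measurableSet_Ioi] with x hx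
  exact (weight_smul_kernelN hμ hlam hx).symm

lemma eLpNorm_kernelN {μ lam : ℝ} (hμ : -(1 / 2 : ℝ) < μ) (hlam : 0 < lam) :
    eLpNorm (kernelN μ lam) 1 (weightedMeasure fun x => x ^ (μ + 1 / 2) / cConst μ) =
      ENNReal.ofReal (1 / lam) := by
  have hc := cConst_pos hμ
  rw [eLpNorm_one_eq_lintegral_enorm,
    ← ofReal_integral_norm_eq_lintegral_enorm (integrable_kernelN hμ hlam), weightedMeasure,
    integral_withDensity_eq_integral_toReal_smul (by fun_prop)
      (.of_forall fun _ => ENNReal.ofReal_lt_top)]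
  congr 1
  have : ∀ x ∈ Set.Ioi (0 : ℝ),
      (ENNReal.ofReal (x ^ (μ + 1 / 2) / cConst μ)).toReal • ‖kernelN μ lam x‖ =
        (lam / 2) ^ μ / 2 / cConst μ * ∫ t in Set.Ioi (0 : ℝ), jointDensity μ lam x t := by
    intro x hx
    -- The kernel is nonnegative, so its norm is the plain integral of the density.
    have hJ : 0 ≤ ∫ t in Set.Ioi (0 : ℝ), jointDensity μ lam x t :=
      setIntegral_nonneg measurableSet_Ioi fun t ht => jointDensity_nonneg μ lam hx ht
    have h := congrArg norm (weight_smul_kernelN hμ hlam hx)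
    rwa [norm_smul, Real.norm_of_nonneg ENNReal.toReal_nonneg, Complex.norm_real,
      Real.norm_of_nonneg (by positivity)] at h
  rw [setIntegral_congr_fun measurableSet_Ioi this, integral_const_mul,
    integral_integral_jointDensity hμ hlam]
  calc _ = (lam / 2) ^ μ / 2 * ((4 / lam) ^ (μ + 1) / 2) * Real.Gamma (μ + 1) / cConst μ := by ring
    _ = 1 / lam := by
      have := (Real.Gamma_pos_of_pos (by linarith : 0 < μ + 1)).ne'
      rw [rpow_const_identity hlam, cConst]
      field_simp

/-! ### The Hankel transform of the kernel -/

lemma hankelIntegrand_kernelN (μ : ℝ) {lam x y : ℝ} (hlam : 0 < lam) (hx : 0 < x) (hy : 0 < y) :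
    hankelIntegrand μ (kernelN μ lam) y x =
      ((y ^ (μ + 1 / 2) / 2 ^ μ * ((lam / 2) ^ μ / 2) *
        ∫ t in Set.Ioi (0 : ℝ), besselEven μ (y * x) * jointDensity μ lam x t : ℝ) : ℂ) := by
  have hJ : √(y * x) * besselJ μ (y * x) =
      y ^ (μ + 1 / 2) / 2 ^ μ * besselEven μ (y * x) * x ^ (μ + 1 / 2) := by
    rw [besselJ_eq_mul_besselEven μ (mul_pos hy hx), Real.sqrt_eq_rpow,
      Real.div_rpow (by positivity) zero_le_two, Real.mul_rpow hy.le hx.le,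
      Real.mul_rpow hy.le hx.le, Real.rpow_add hx, Real.rpow_add hy]
    ring
  rw [hankelIntegrand, hJ, Complex.ofReal_mul, mul_assoc, rpow_mul_kernelN μ hlam hx,
    ← Complex.ofReal_mul, integral_const_mul]
  congr 1
  ring

lemma integrableOn_hankelIntegrand_kernelN {μ lam y : ℝ} (hμ : -(1 / 2 : ℝ) < μ)
    (hlam : 0 < lam) (hy : 0 < y) :
    IntegrableOn (hankelIntegrand μ (kernelN μ lam) y) (Set.Ioi 0) := by
  refine (((integrable_besselEven_mul_jointDensity hμ hlam y).integral_prod_left.const_mul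
    (y ^ (μ + 1 / 2) / 2 ^ μ * ((lam / 2) ^ μ / 2))).ofReal (𝕜 := ℂ)).congr ?_
  filter_upwards [ae_restrict_mem measurableSet_Ioi] with x hx
  exact (hankelIntegrand_kernelN μ hlam hx hy).symm

lemma hankelTransform_kernelN {μ lam y : ℝ} (hμ : -(1 / 2 : ℝ) < μ) (hlam : 0 < lam)
    (hy : 0 < y) :
    hankelTransform μ (kernelN μ lam) y =
      ((y ^ (μ + 1 / 2) / (lam + y ^ 2) : ℝ) : ℂ) := by
  rw [hankelTransform, setIntegral_congr_fun measurableSet_Ioi fun x hx =>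
    hankelIntegrand_kernelN μ hlam hx hy, integral_complex_ofReal, integral_const_mul,
    integral_integral_besselEven_mul_jointDensity hμ hlam]
  congr 1
  calc _ = y ^ (μ + 1 / 2) / 2 ^ μ * ((lam / 2) ^ μ / 2 * ((4 / lam) ^ (μ + 1) / 2)) *
        (lam / (lam + y ^ 2)) := by ring
    _ = _ := by
      have : (0 : ℝ) < 2 ^ μ := by positivity
      rw [rpow_const_identity hlam]
      field_simp

end HankelKernel

theorem mainTheorem10 (μ : ℝ) (hμ : -(1 / 2 : ℝ) < μ) (lam : ℝ) (hlam : 0 < lam) :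
    -- the spaces `L^1(sr)` and `L^1(r⁻¹ / c_μ)` are the same
    (HankelKernel.weightedMeasure
        (fun x => HankelKernel.sWeight μ x * HankelKernel.rWeight μ x) =
      HankelKernel.weightedMeasure
        (fun x => (HankelKernel.rWeight μ x)⁻¹ / HankelKernel.cConst μ)) ∧
    -- `N_λ` lies in `L^1(sr)`, with norm `1 / λ`
    MeasureTheory.MemLp (HankelKernel.kernelN μ lam) 1
      (HankelKernel.weightedMeasure
        (fun x => HankelKernel.sWeight μ x * HankelKernel.rWeight μ x)) ∧
    MeasureTheory.eLpNorm (HankelKernel.kernelN μ lam) 1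
      (HankelKernel.weightedMeasure
        (fun x => HankelKernel.sWeight μ x * HankelKernel.rWeight μ x)) =
      ENNReal.ofReal (1 / lam) ∧
    -- the Hankel transform of `N_λ` is given by an absolutely convergent integral, with the value
    ∀ y : ℝ, 0 < y →
      MeasureTheory.IntegrableOn
        (HankelKernel.hankelIntegrand μ (HankelKernel.kernelN μ lam) y) (Set.Ioi 0) ∧
      HankelKernel.hankelTransform μ (HankelKernel.kernelN μ lam) y =
        ((y ^ (μ + 1 / 2) / (lam + y ^ 2) : ℝ) : ℂ) := by
  rw [HankelKernel.weightedMeasure_sWeight_mul_rWeight, HankelKernel.weightedMeasure_inv_rWeight]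
  exact ⟨rfl, memLp_one_iff_integrable.2 (HankelKernel.integrable_kernelN hμ hlam),
    HankelKernel.eLpNorm_kernelN hμ hlam, fun y hy =>
      ⟨HankelKernel.integrableOn_hankelIntegrand_kernelN hμ hlam hy,
        HankelKernel.hankelTransform_kernelN hμ hlam hy⟩⟩
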